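/- Graphormer-GD, PRD-WL, DiffWire and random walk based GNNs are incomplete on graphs with simple spectrum. Precisely: Let $G$ be a finite simple graph with adjacency matrix $A$, degree matrix $D$, Laplacian $L=D-A$, normalized Laplacian $\mathcal L=D^{-1/2}LD^{-1/2}$ and random walk matrix $P=D^{-1}A$. For $M\in\{A,L,\mathcal L\}$, let $\mathcal D_n^M$ be the set of connected graphs on $n$ vertices for which the eigenvalues of $M$ are pairwise distinct. A parametric family $(f_\theta)_{\theta\in\Theta}$ of functions of graphs is called *complete* on a set $\mathcal D$ of graphs if for any two non-isomorphic $G,H\in\mathcal D$ there is a $\theta$ with $f_\theta(G)\ne f_\theta(H)$. Then for every $M\in\{A,L,\mathcal L\}$ and for each of the following four families there is an $n$ such that the family is not complete on $\mathcal D_n^M$. A message passing network with pair feature $d_G(u,v)$ is given by a number $T$ of iterations and arbitrary maps $\mathrm{INIT}$, $\mathrm{UPDATE}_t$, $\mathrm{READOUT}$, and computes $$h_v^{(0)}=\mathrm{INIT}(d_G(v,v)),\qquad h_v^{(t+1)}=\mathrm{UPDATE}_t\big(h_v^{(t)},\{\!\{(h_u^{(t)},d_G(v,u)) : u\in V\}\!\}\big),\qquad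 f(G)=\mathrm{READOUT}(\{\!\{h_v^{(T)}: v\in V\}\!\})\in\mathbb R^m .$$ 1. *Graphormer-GD*: graph transformers with distance $d_G(u,v)=(\text{shortest path distance},\text{resistance distance})$. The initial node features, the rows of $X^{(0)}$, are an arbitrary function of the degree; layer $t$ computes $Y=\sum_h\big[\varphi_1^{h}(d_G)\odot\mathrm{softmax}\big(XW_Q^h(XW_K^h)^\top+\varphi_2^{h}(d_G)\big)\big]XW_V^hW_O^h$ with arbitrary weight matrices and arbitrary entrywise functions $\varphi_1^h,\varphi_2^h$, depending on the layer, followed by an arbitrary node-wise map $(X_v,Y_v)\mapsto X_v^{\mathrm{new}}$; the output is an arbitrary function of the multiset of the final node features. 2. *PRD-WL*: message passing networks with pair feature $\big(A_{uv},\sum_{k\ge0}\gamma_k(P^k)_{uv}\big)$ (adjacency and PageRank distance), for an arbitrary summable real sequence $(\gamma_k)$. 3. *DiffWire*: message passing networks whose pair feature consists of $A_{uv}$, the commute time of $u,v$ under the simple random walk, and, for both $L$ and $\mathcal L$, the smallest positive eigenvalue and the $(u,v)$ entry of the orthogonal projection onto its eigenspace. 4. *Random walk based GNNs*: message passing networks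 whose pair feature consists of $A_{uv}$, all the $k$-step probabilities $((P^k)_{uv})_{k\ge0}$, the hitting times from $u$ to $v$ and from $v$ to $u$, the commute time, and the effective resistance of $u,v$. -/

import Mathlib

open scoped ENNReal

noncomputable section

namespace SpectralGNN

/-! ### Matrices attached to a finite graph, and simple spectrum -/

section Matrices

variable {V : Type*} [Fintype V] [DecidableEq V]

open Classical in
/-- The adjacency matrix `A`. -/
def adjacency (G : SimpleGraph V) : Matrix V V ℝ := G.adjMatrix ℝ

open Classical in
/-- The (unnormalized) Laplacian `L = D - A`. -/
def laplacian (G : SimpleGraph V) : Matrix V V ℝ := G.lapMatrix ℝ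

open Classical in
/-- The degree of a vertex. -/
def deg (G : SimpleGraph V) (v : V) : ℕ := G.degree v

/-- The normalized Laplacian `D^(-1/2) L D^(-1/2)`. -/
def normalizedLaplacian (G : SimpleGraph V) : Matrix V V ℝ :=
  Matrix.of fun u v => laplacian G u v / (√(deg G u : ℝ) * √(deg G v : ℝ))

/-- The transition matrix `P = D⁻¹ A` of the simple random walk. -/
def transition (G : SimpleGraph V) : Matrix V V ℝ :=
  Matrix.of fun u v => adjacency G u v / (deg G u : ℝ)

/-- A real symmetric matrix has simple spectrum if its eigenvalues, listed with multiplicity,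
are pairwise distinct. -/
def HasSimpleSpectrum (M : Matrix V V ℝ) : Prop :=
  ∃ hM : M.IsHermitian, Function.Injective hM.eigenvalues

end Matrices

/-- The matrices by which a graph is represented. -/
inductive GraphMatrix
  | adjacency
  | laplacian
  | normalizedLaplacian

/-- The matrix of the chosen kind attached to a graph. -/
def GraphMatrix.toMatrix {V : Type*} [Fintype V] [DecidableEq V] :
    GraphMatrix → SimpleGraph V → Matrix V V ℝ
  | .adjacency => SpectralGNN.adjacency
  | .laplacian => SpectralGNN.laplacian
  | .normalizedLaplacian => SpectralGNN.normalizedLaplacian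

/-- The connected graphs on `n` vertices whose matrix of the given kind has simple spectrum. -/
def simpleSpectrumGraphs (M : GraphMatrix) (n : ℕ) : Set (SimpleGraph (Fin n)) :=
  {G | G.Connected ∧ HasSimpleSpectrum (M.toMatrix G)}

/-- A parametric family `(f θ)` of functions of graphs on the vertex set `V` is complete on `D` if
any two non-isomorphic graphs of `D` are separated by some `f θ`. -/
def IsComplete {V : Type*} {Θ : Type*} {Y : Θ → Type*} (f : ∀ θ, SimpleGraph V → Y θ)
    (D : Set (SimpleGraph V)) : Prop :=
  ∀ G ∈ D, ∀ H ∈ D, ¬ Nonempty (G ≃g H) → ∃ θ, f θ G ≠ f θ H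

/-! ### Distances and other pair features -/

section Features

variable {V : Type*} [Fintype V] [DecidableEq V]

/-- The resistance distance `Γ u u + Γ v v - 2 Γ u v`, where `Γ = (L + (1/n) J)⁻¹` and `J` is the
all-ones matrix. (`L + (1/n) J` is invertible if the graph is connected, and then
`Γ - (1/n) J` is the pseudoinverse of `L`.) -/
def resistance (G : SimpleGraph V) (u v : V) : ℝ :=
  let Γ : Matrix V V ℝ := (laplacian G + Matrix.of fun _ _ => 1 / (Fintype.card V : ℝ))⁻¹
  Γ u u + Γ v v - 2 * Γ u v

/-- The probability that the simple random walk from `u` does not visit `v` at times `0, …, k`. -/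
def survival (G : SimpleGraph V) (v : V) : ℕ → V → ℝ
  | 0, u => if u = v then 0 else 1
  | k + 1, u => if u = v then 0 else ∑ w, transition G u w * survival G v k w

/-- The hitting time: the expected time at which the simple random walk from `u` first visits `v`,
as the sum over `k ≥ 0` of the probability that this time exceeds `k`. -/
def hittingTime (G : SimpleGraph V) (u v : V) : ℝ≥0∞ :=
  ∑' k, ENNReal.ofReal (survival G v k u)

/-- The commute time: the expected duration of a round trip from `u` to `v` and back. -/
def commuteTime (G : SimpleGraph V) (u v : V) : ℝ≥0∞ :=
  hittingTime G u v + hittingTime G v u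

/-- The (generalized) PageRank distance with weights `γ`: the sum over `k` of `γ k` times the
probability that the simple random walk from `u` is at `v` after `k` steps. -/
def pageRank (γ : ℕ → ℝ) (G : SimpleGraph V) (u v : V) : ℝ :=
  ∑' k, γ k * (transition G ^ k) u v

/-- The spectral gap of a positive semidefinite matrix: its smallest positive eigenvalue. -/
def spectralGap (M : Matrix V V ℝ) : ℝ :=
  sInf {μ : ℝ | 0 < μ ∧ Module.End.HasEigenvalue (Matrix.toEuclideanLin M) μ}

/-- The `(u, v)` entry of the orthogonal projection onto the eigenspace of the spectral gap. If
this eigenvalue is simple with unit eigenvector `f` (the Fiedler vector, for a Laplacian), this is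
`f u * f v`. -/
def gapProjection (M : Matrix V V ℝ) (u v : V) : ℝ :=
  (Module.End.eigenspace (Matrix.toEuclideanLin M) (spectralGap M)).starProjection
    (EuclideanSpace.single v 1) u

end Features

/-! ### Message passing with pair features -/

/-- A message passing network whose messages carry a pair feature with values in `α`; the hidden
states live in an arbitrary set, and all maps are arbitrary. -/
structure PairGNN (α : Type) where
  /-- the set of hidden states -/
  State : Type
  /-- the number of iterations -/
  iterations : ℕ
  /-- the dimension of the output -/
  outDim : ℕ
  /-- the initial state of a vertex `v`, a function of the feature of `(v, v)` -/
  init : α → State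
  /-- the map that updates a vertex, given its state and the multiset of all messages -/
  update : ℕ → State → Multiset (State × α) → State
  /-- the global pooling -/
  readout : Multiset State → Fin outDim → ℝ

namespace PairGNN

variable {α : Type} (N : PairGNN α) {V : Type*} [Fintype V]

/-- The state of each vertex after `t` iterations, for the pair feature `d`. -/
def hidden (d : V → V → α) : ℕ → V → N.State
  | 0, v => N.init (d v v)
  | t + 1, v => N.update t (hidden d t v)
      (Finset.univ.val.map fun u => (hidden d t u, d v u))

/-- The output of the network, for the pair feature `d`. -/
def eval (d : V → V → α) : Fin N.outDim → ℝ :=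
  N.readout (Finset.univ.val.map (N.hidden d N.iterations))

end PairGNN

/-! ### Graphormer-GD -/

/-- Row-wise softmax of a square matrix. -/
def softmax {V : Type*} [Fintype V] (S : Matrix V V ℝ) : Matrix V V ℝ :=
  Matrix.of fun u v => Real.exp (S u v) / ∑ w, Real.exp (S u w)

/-- The parameters of a Graphormer-GD network: a graph transformer whose attention uses the
generalized distance (shortest path distance, resistance distance). -/
structure GraphormerGD where
  /-- the width `d` of the node features -/
  width : ℕ
  /-- the number of attention heads in a layer -/
  heads : ℕ
  /-- the width of an attention head -/
  headWidth : ℕ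
  /-- the number of layers -/
  layers : ℕ
  /-- the dimension of the output -/
  outDim : ℕ
  /-- the initial node features (degree encoding) -/
  embed : ℕ → Fin width → ℝ
  /-- the matrices `W_Q` -/
  query : ℕ → Fin heads → Matrix (Fin width) (Fin headWidth) ℝ
  /-- the matrices `W_K` -/
  key : ℕ → Fin heads → Matrix (Fin width) (Fin headWidth) ℝ
  /-- the matrices `W_V` -/
  value : ℕ → Fin heads → Matrix (Fin width) (Fin headWidth) ℝ
  /-- the matrices `W_O` -/
  proj : ℕ → Fin heads → Matrix (Fin headWidth) (Fin width) ℝ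
  /-- the multiplicative function `φ₁` of the distance -/
  φ₁ : ℕ → Fin heads → ℕ∞ × ℝ → ℝ
  /-- the additive function `φ₂` of the distance -/
  φ₂ : ℕ → Fin heads → ℕ∞ × ℝ → ℝ
  /-- the node-wise map after attention (residual connection, normalization and feed-forward
  network), a function of the previous feature and of the attention output -/
  feedForward : ℕ → (Fin width → ℝ) → (Fin width → ℝ) → Fin width → ℝ
  /-- the global pooling -/
  readout : Multiset (Fin width → ℝ) → Fin outDim → ℝ

namespace GraphormerGD

variable (N : GraphormerGD) {V : Type*} [Fintype V] [DecidableEq V]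

/-- The generalized distance (shortest path distance, resistance distance). -/
def distance (G : SimpleGraph V) (u v : V) : ℕ∞ × ℝ := (G.edist u v, resistance G u v)

/-- The attention output of layer `t` on node features `X`: the sum over the heads `h` of
`(φ₁(D) ⊙ softmax(X W_Q (X W_K)ᵀ + φ₂(D))) X W_V W_O`. -/
def attention (G : SimpleGraph V) (t : ℕ) (X : Matrix V (Fin N.width) ℝ) :
    Matrix V (Fin N.width) ℝ :=
  ∑ h, Matrix.hadamard (Matrix.of fun u v => N.φ₁ t h (distance G u v))
      (softmax ((X * N.query t h) * (X * N.key t h).transpose +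
        Matrix.of fun u v => N.φ₂ t h (distance G u v))) *
    (X * N.value t h) * N.proj t h

/-- The node features after `t` layers. -/
def hidden (G : SimpleGraph V) : ℕ → Matrix V (Fin N.width) ℝ
  | 0 => Matrix.of fun v => N.embed (deg G v)
  | t + 1 => Matrix.of fun v =>
      N.feedForward t (hidden G t v) (N.attention G t (hidden G t) v)

/-- The function of graphs computed by the network. -/
def eval (G : SimpleGraph V) : Fin N.outDim → ℝ :=
  N.readout (Finset.univ.val.map fun v => N.hidden G N.layers v)

end GraphormerGD

/-! ### PRD-WL, DiffWire and random walk based networks -/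

section Models

variable {V : Type*} [Fintype V] [DecidableEq V]

/-- The pair feature of PRD-WL: adjacency and PageRank distance with weights `γ`. -/
def prdFeature (γ : ℕ → ℝ) (G : SimpleGraph V) (u v : V) : ℝ × ℝ :=
  (adjacency G u v, pageRank γ G u v)

/-- PRD-WL: color refinement with the PageRank distance. The parameters are a summable sequence of
weights and the maps of the refinement. -/
def prdWL (θ : {γ : ℕ → ℝ // Summable γ} × PairGNN (ℝ × ℝ)) (G : SimpleGraph V) :
    Fin θ.2.outDim → ℝ :=
  θ.2.eval (prdFeature θ.1.1 G)

/-- The data on which the two rewiring layers of DiffWire act. -/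
structure DiffWireFeature where
  /-- the adjacency matrix -/
  adj : ℝ
  /-- commute times -/
  commute : ℝ≥0∞
  /-- the spectral gap of the Laplacian -/
  gap : ℝ
  /-- the entries `f u * f v`, for the Fiedler vector `f` of the Laplacian -/
  fiedler : ℝ
  /-- the spectral gap of the normalized Laplacian -/
  normGap : ℝ
  /-- the entries `f u * f v`, for the Fiedler vector `f` of the normalized Laplacian -/
  normFiedler : ℝ

/-- The pair feature of DiffWire: adjacency, commute time (used by the commute time layer), and
the spectral gap with the Fiedler vector up to sign (used by the spectral gap layer). -/
def diffWireFeature (G : SimpleGraph V) (u v : V) : DiffWireFeature where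
  adj := adjacency G u v
  commute := commuteTime G u v
  gap := spectralGap (laplacian G)
  fiedler := gapProjection (laplacian G) u v
  normGap := spectralGap (normalizedLaplacian G)
  normFiedler := gapProjection (normalizedLaplacian G) u v

/-- DiffWire networks. -/
def diffWire (N : PairGNN DiffWireFeature) (G : SimpleGraph V) : Fin N.outDim → ℝ :=
  N.eval (diffWireFeature G)

/-- The quantities of the simple random walk used as features of a pair. -/
structure RandomWalkFeature where
  /-- the adjacency matrix -/
  adj : ℝ
  /-- the probability of being at `v` after `k` steps from `u`, for all `k` -/
  landing : ℕ → ℝ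
  /-- the hitting time from `u` to `v` -/
  hitting : ℝ≥0∞
  /-- the hitting time from `v` to `u` -/
  hittingBack : ℝ≥0∞
  /-- the commute time between `u` and `v` -/
  commute : ℝ≥0∞
  /-- the effective resistance between `u` and `v` -/
  effRes : ℝ

/-- The pair feature of random walk based networks. -/
def randomWalkFeature (G : SimpleGraph V) (u v : V) : RandomWalkFeature where
  adj := adjacency G u v
  landing := fun k => (transition G ^ k) u v
  hitting := hittingTime G u v
  hittingBack := hittingTime G v u
  commute := commuteTime G u v
  effRes := resistance G u v

/-- Random walk based networks. -/
def randomWalkGNN (N : PairGNN RandomWalkFeature) (G : SimpleGraph V) : Fin N.outDim → ℝ :=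
  N.eval (randomWalkFeature G)

end Models

end SpectralGNN

end

noncomputable section

namespace SpectralGNN

open Polynomial

/-! ### Bisimulations: the bijective three-pebble game -/

section Bisimulation

variable {V : Type*}

/-! All four families are bounded by the bijective three-pebble game, and this game fails to
separate some graphs with simple spectrum. If related pairs of vertices have equal adjacency, their
entries agree in every matrix obtained from `A` by entrywise operations and products, because the
third pebble matches the summands of a product (`Compat.sum_mul`). By Cayley–Hamilton and Lagrange
interpolation this extends to inverses, spectra and spectral projections. So every pair feature
agrees (`Compat.distance`, `Compat.prdFeature`, `Compat.diffWireFeature`,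
`Compat.randomWalkFeature`), and by induction on the layers so do all hidden states
(`PairGNN.eval_eq`, `GraphormerGD.eval_eq`). The graphs are a Cai–Fürer–Immerman pair over `K₄`:
four fibers `(ℤ/2)²`, any two joined through one of the three nonzero functionals, with a twist `t`
between fibers 2 and 3. A fifth fiber of two vertices makes the degrees of the fibers distinct. Only
a global parity sees the twist: a 4-clique meeting the four large fibers exists only for `t = 0`.
Simplicity of the three spectra is certified by cyclic vectors modulo a prime, and passes to the
twisted graph since the spectra coincide. -/

/-- A back-and-forth system for the bijective three-pebble game: a relation between the pairs of
vertices of two structures. -/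
structure Bisimulation (R : V → V → V → V → Prop) : Prop where
  extend : ∀ {u v u' v'}, R u v u' v' → ∃ π : Equiv.Perm V, ∀ w, R u w u' (π w) ∧ R w v (π w) v'
  swap : ∀ {u v u' v'}, R u v u' v' → R v u v' u'
  eq_iff : ∀ {u v u' v'}, R u v u' v' → (u = v ↔ u' = v')
  nonempty : ∃ u v u' v', R u v u' v'

namespace Bisimulation

variable {R : V → V → V → V → Prop} (hR : Bisimulation R)
include hR

theorem flip : Bisimulation fun u v u' v' => R u' v' u v where
  extend h := by
    obtain ⟨π, hπ⟩ := hR.extend h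
    exact ⟨π.symm, fun w => by simpa using hπ (π.symm w)⟩
  swap h := hR.swap h
  eq_iff h := (hR.eq_iff h).symm
  nonempty := by
    obtain ⟨u, v, u', v', h⟩ := hR.nonempty
    exact ⟨u', v', u, v, h⟩

theorem exists_image (u v : V) : ∃ u' v', R u v u' v' := by
  obtain ⟨a, b, a', b', h⟩ := hR.nonempty
  obtain ⟨π, hπ⟩ := hR.extend h
  obtain ⟨ρ, hρ⟩ := hR.extend (hR.swap (hπ u).1)
  exact ⟨_, _, (hρ v).1⟩

theorem diag_left {u v u' v' : V} (h : R u v u' v') : R u u u' u' := by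
  obtain ⟨π, hπ⟩ := hR.extend h
  have h1 := (hπ u).1
  -- `h1` relates `(u, u)` to `(u', π u)`, so preservation of equality forces `π u = u'`.
  rwa [← (hR.eq_iff h1).1 rfl] at h1

theorem diag_right {u v u' v' : V} (h : R u v u' v') : R v v v' v' := hR.diag_left (hR.swap h)

/-- Every pair of similar vertices is matched by a bijection that preserves pairs and vertices. -/
theorem extend_diag {v v' : V} (h : R v v v' v') :
    ∃ π : Equiv.Perm V, ∀ w, R v w v' (π w) ∧ R w w (π w) (π w) := by
  obtain ⟨π, hπ⟩ := hR.extend h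
  exact ⟨π, fun w => ⟨(hπ w).1, hR.diag_right (hπ w).1⟩⟩

theorem exists_perm_diag : ∃ π : Equiv.Perm V, ∀ w, R w w (π w) (π w) := by
  obtain ⟨u, v, u', v', h⟩ := hR.nonempty
  obtain ⟨π, hπ⟩ := hR.extend_diag (hR.diag_left h)
  exact ⟨π, fun w => (hπ w).2⟩

end Bisimulation

/-- Two functions of pairs agree on all pairs that are related by `R`. -/
def Compat {α : Type*} (R : V → V → V → V → Prop) (X Y : V → V → α) : Prop :=
  ∀ ⦃u v u' v'⦄, R u v u' v' → X u v = Y u' v'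

end Bisimulation

theorem map_univ_val_eq_of_perm {V α : Type*} [Fintype V] {f g : V → α} (π : Equiv.Perm V)
    (h : ∀ w, f w = g (π w)) : Finset.univ.val.map f = Finset.univ.val.map g := by
  have : f = g ∘ π := funext h
  rw [this, ← Multiset.map_map, Multiset.map_univ_val_equiv]

theorem exists_perm_of_card_fiber_eq {V α : Type*} [Fintype V] [DecidableEq α] {f g : V → α}
    (h : ∀ c, (Finset.univ.filter fun w => f w = c).card =
      (Finset.univ.filter fun w => g w = c).card) :
    ∃ π : Equiv.Perm V, ∀ w, f w = g (π w) := by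
  have hc : ∀ c, Nonempty ({w // f w = c} ≃ {w // g w = c}) := fun c => by
    rw [← Fintype.card_eq, Fintype.card_subtype, Fintype.card_subtype, h]
  let e : ∀ c, {w // f w = c} ≃ {w // g w = c} := fun c => (hc c).some
  refine ⟨(Equiv.sigmaFiberEquiv f).symm.trans
    ((Equiv.sigmaCongrRight e).trans (Equiv.sigmaFiberEquiv g)), fun w => ?_⟩
  exact (e (f w) ⟨w, rfl⟩).2.symm

/-! ### Compatible matrices -/

section CompatMatrix

variable {V : Type*} {R : V → V → V → V → Prop}

namespace Compat

theorem map₂ {α β γ : Type*} {X Y : V → V → α} {X' Y' : V → V → β} (h : Compat R X Y)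
    (h' : Compat R X' Y') (f : α → β → γ) :
    Compat R (fun u v => f (X u v) (X' u v)) (fun u v => f (Y u v) (Y' u v)) :=
  fun _ _ _ _ r => by simp only [h r, h' r]

theorem flip {α : Type*} {X Y : V → V → α} (h : Compat R X Y) :
    Compat (fun u v u' v' => R u' v' u v) Y X := fun _ _ _ _ r => (h r).symm

variable {X Y X' Y' : Matrix V V ℝ}

theorem add (h : Compat R X Y) (h' : Compat R X' Y') : Compat R (X + X') (Y + Y') :=
  fun _ _ _ _ r => by simp only [Matrix.add_apply, h r, h' r]

theorem sub (h : Compat R X Y) (h' : Compat R X' Y') : Compat R (X - X') (Y - Y') :=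
  fun _ _ _ _ r => by simp only [Matrix.sub_apply, h r, h' r]

theorem smul (h : Compat R X Y) (c : ℝ) : Compat R (c • X) (c • Y) :=
  fun _ _ _ _ r => by simp only [Matrix.smul_apply, h r]

theorem one [DecidableEq V] (hR : Bisimulation R) :
    Compat R (1 : Matrix V V ℝ) (1 : Matrix V V ℝ) :=
  fun _ _ _ _ r => by simp only [Matrix.one_apply, hR.eq_iff r]

variable [Fintype V]

/-- The bijection of the third pebble controls `(u, w)` and `(w, v)` at once, so it matches the sums
term by term. This is the step that needs three pebbles rather than two. -/
theorem sum_mul (hR : Bisimulation R) {X Y X' Y' : V → V → ℝ}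
    (h : Compat R X Y) (h' : Compat R X' Y') :
    Compat R (fun u v => ∑ w, X u w * X' w v) (fun u v => ∑ w, Y u w * Y' w v) :=
  fun _ _ _ _ r => by
    obtain ⟨π, hπ⟩ := hR.extend r
    exact Fintype.sum_equiv π _ _ fun w => by rw [h (hπ w).1, h' (hπ w).2]

theorem mul (hR : Bisimulation R) (h : Compat R X Y) (h' : Compat R X' Y') :
    Compat R (X * X') (Y * Y') := h.sum_mul hR h'

variable [DecidableEq V]

theorem pow (hR : Bisimulation R) (h : Compat R X Y) (k : ℕ) : Compat R (X ^ k) (Y ^ k) := by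
  induction k with
  | zero => simpa only [pow_zero] using one hR
  | succ k ih => simpa only [pow_succ] using ih.mul hR h

theorem aeval (hR : Bisimulation R) (h : Compat R X Y) (p : ℝ[X]) :
    Compat R (Polynomial.aeval X p) (Polynomial.aeval Y p) := by
  induction p using Polynomial.induction_on' with
  | add p q hp hq => simpa only [map_add] using hp.add hq
  | monomial k c =>
    simpa only [Polynomial.aeval_monomial, Algebra.algebraMap_eq_smul_one, smul_mul_assoc, one_mul]
      using (h.pow hR k).smul c

omit [Fintype V] [DecidableEq V] in
theorem eq_zero (hR : Bisimulation R) (h : Compat R X Y) (hY : Y = 0) : X = 0 := by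
  ext u v
  obtain ⟨u', v', r⟩ := hR.exists_image u v
  rw [h r, hY]; rfl

/-- Every pair occurs on either side of the relation, so a vanishing matrix is compatible only with
zero. Compatible matrices thus have the same annihilating polynomials. -/
theorem aeval_eq_zero (hR : Bisimulation R) (h : Compat R X Y) (p : ℝ[X])
    (hX : Polynomial.aeval X p = 0) : Polynomial.aeval Y p = 0 :=
  (h.aeval hR p).flip.eq_zero hR.flip hX

end Compat

/-- By Cayley–Hamilton, as the constant coefficient of the characteristic polynomial is nonzero. The
identity is phrased as an annihilating polynomial so that it transfers to compatible matrices. -/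
theorem exists_aeval_mul_self_eq_one [Fintype V] [DecidableEq V] {X : Matrix V V ℝ}
    (hX : IsUnit X) : ∃ q : ℝ[X], Polynomial.aeval X (q * Polynomial.X - 1) = 0 := by
  have hc : X.charpoly.coeff 0 ≠ 0 := by
    intro h0
    have h1 := Matrix.det_eq_sign_charpoly_coeff X
    rw [h0, mul_zero] at h1
    exact ((Matrix.isUnit_iff_isUnit_det X).1 hX).ne_zero h1
  refine ⟨C (-(X.charpoly.coeff 0)⁻¹) * X.charpoly.divX, ?_⟩
  have : C (-(X.charpoly.coeff 0)⁻¹) * X.charpoly.divX * Polynomial.X - 1 =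
      C (-(X.charpoly.coeff 0)⁻¹) * X.charpoly := by
    have h1 := Polynomial.divX_mul_X_add X.charpoly
    generalize X.charpoly.divX = d at h1 ⊢
    generalize X.charpoly.coeff 0 = c at hc h1 ⊢
    rw [← h1, mul_add, ← C_mul, neg_mul, inv_mul_cancel₀ hc]
    simp only [map_neg, map_one]
    ring
  rw [this, map_mul, Matrix.aeval_self_charpoly, mul_zero]

namespace Compat

variable [Fintype V] [DecidableEq V] {X Y : Matrix V V ℝ}

theorem isUnit_of_isUnit (hR : Bisimulation R) (h : Compat R X Y) (hX : IsUnit X) : IsUnit Y := by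
  obtain ⟨q, hq⟩ := exists_aeval_mul_self_eq_one hX
  have := h.aeval_eq_zero hR _ hq
  rw [map_sub, map_mul, Polynomial.aeval_X, map_one, sub_eq_zero] at this
  exact (Matrix.isUnit_iff_isUnit_det Y).2 (Matrix.isUnit_det_of_left_inverse this)

theorem isUnit_iff (hR : Bisimulation R) (h : Compat R X Y) : IsUnit X ↔ IsUnit Y :=
  ⟨h.isUnit_of_isUnit hR, h.flip.isUnit_of_isUnit hR.flip⟩

theorem inv (hR : Bisimulation R) (h : Compat R X Y) :
    Compat R (X⁻¹ : Matrix V V ℝ) (Y⁻¹ : Matrix V V ℝ) := by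
  by_cases hX : IsUnit X
  · obtain ⟨q, hq⟩ := exists_aeval_mul_self_eq_one hX
    have hq' := h.aeval_eq_zero hR _ hq
    rw [map_sub, map_mul, Polynomial.aeval_X, map_one, sub_eq_zero] at hq hq'
    rw [Matrix.inv_eq_left_inv hq, Matrix.inv_eq_left_inv hq']
    exact h.aeval hR q
  -- Both matrices are singular, and the inverse of a singular matrix is zero by convention.
  · have hY := mt (h.isUnit_iff hR).2 hX
    rw [Matrix.isUnit_iff_isUnit_det] at hX hY
    rw [Matrix.nonsing_inv_apply_not_isUnit _ hX, Matrix.nonsing_inv_apply_not_isUnit _ hY]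
    exact fun _ _ _ _ _ => rfl

theorem spectrum_eq (hR : Bisimulation R) (h : Compat R X Y) : spectrum ℝ X = spectrum ℝ Y := by
  ext μ
  rw [spectrum.mem_iff, spectrum.mem_iff, not_iff_not, Algebra.algebraMap_eq_smul_one]
  exact (((one hR).smul μ).sub h).isUnit_iff hR

end Compat

/-! ### Spectral gap and projections -/

variable [Fintype V] [DecidableEq V]

theorem spectralGap_eq_sInf_spectrum (M : Matrix V V ℝ) :
    spectralGap M = sInf {μ : ℝ | 0 < μ ∧ μ ∈ spectrum ℝ M} := by
  unfold spectralGap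
  simp only [Module.End.hasEigenvalue_iff_mem_spectrum]
  rw [Matrix.spectrum_toLpLin]

theorem Compat.spectralGap_eq (hR : Bisimulation R) {X Y : Matrix V V ℝ} (h : Compat R X Y) :
    spectralGap X = spectralGap Y := by
  rw [spectralGap_eq_sInf_spectrum, spectralGap_eq_sInf_spectrum, h.spectrum_eq hR]

/-- The orthogonal projection onto an eigenspace of a symmetric matrix is a polynomial in the
matrix, which depends on the spectrum only. -/
theorem starProjection_eigenspace_eq_aeval {M : Matrix V V ℝ} (hM : M.IsHermitian) {S : Finset ℝ}
    (hS : spectrum ℝ M = S) (μ : ℝ) (u v : V) :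
    (Module.End.eigenspace (Matrix.toEuclideanLin M) μ).starProjection
      (EuclideanSpace.single v 1) u =
    Polynomial.aeval M (Lagrange.interpolate S id fun x => if x = μ then 1 else 0) u v := by
  set q : ℝ[X] := Lagrange.interpolate S id fun x => if x = μ then 1 else 0 with hq
  have hqe : ∀ x ∈ S, q.eval x = if x = μ then 1 else 0 := fun x hx => by
    have := Lagrange.eval_interpolate_at_node (s := S) (v := id)
      (fun x => if x = μ then (1 : ℝ) else 0) (Function.injective_id.injOn) hx
    simpa only [id] using this
  set E := Module.End.eigenspace (Matrix.toEuclideanLin M) μ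
  -- Both sides are linear, so it is enough to compare them on the eigenvector basis, where the
  -- polynomial acts by its value at the eigenvalue.
  have key : (E.starProjection : EuclideanSpace ℝ V →ₗ[ℝ] EuclideanSpace ℝ V) =
      Matrix.toEuclideanLin (Polynomial.aeval M q) := by
    refine hM.eigenvectorBasis.toBasis.ext fun j => ?_
    rw [OrthonormalBasis.coe_toBasis]
    set x := hM.eigenvectorBasis j
    have hx : Matrix.toEuclideanLin M x = hM.eigenvalues j • x := by
      ext i
      exact congrFun (hM.mulVec_eigenvectorBasis j) i
    have hmem : hM.eigenvalues j ∈ S := by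
      rw [← Finset.mem_coe, ← hS, hM.spectrum_real_eq_range_eigenvalues]
      exact ⟨j, rfl⟩
    have hpow : ∀ k, Matrix.toEuclideanLin (M ^ k) x = hM.eigenvalues j ^ k • x := fun k => by
      induction k with
      | zero => ext i; simp
      | succ k ih =>
        have : Matrix.toEuclideanLin (M ^ (k + 1)) x =
            Matrix.toEuclideanLin (M ^ k) (Matrix.toEuclideanLin M x) := by
          ext i; simp [pow_succ]
        rw [this, hx, map_smul, ih, smul_smul, pow_succ, mul_comm]
    have hval : ∀ p : ℝ[X], Matrix.toEuclideanLin (Polynomial.aeval M p) x =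
        p.eval (hM.eigenvalues j) • x := fun p => by
      induction p using Polynomial.induction_on' with
      | add p r hp hr => rw [map_add, map_add, LinearMap.add_apply, hp, hr, eval_add, add_smul]
      | monomial k c =>
        rw [aeval_monomial, Algebra.algebraMap_eq_smul_one, smul_mul_assoc, one_mul, map_smul,
          LinearMap.smul_apply, hpow, smul_smul, eval_monomial]
    rw [hval, hqe _ hmem]
    split_ifs with hj
    · rw [one_smul]
      refine Submodule.starProjection_eq_self_iff.2 (Module.End.mem_eigenspace_iff.2 ?_)
      rw [hx, hj]
    · rw [zero_smul]
      refine (Submodule.starProjection_apply_eq_zero_iff E).2 fun y hy => ?_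
      rw [Module.End.mem_eigenspace_iff] at hy
      have hs := Matrix.isSymmetric_toEuclideanLin_iff.2 hM y x
      rw [hy, hx, inner_smul_left, inner_smul_right] at hs
      have : (μ - hM.eigenvalues j) * inner ℝ y x = 0 := by
        rw [sub_mul]; exact sub_eq_zero.2 hs
      exact (mul_eq_zero.1 this).resolve_left (sub_ne_zero.2 (Ne.symm hj))
  have := congrArg (fun f => f (EuclideanSpace.single v 1) u) key
  simpa using this

theorem Compat.gapProjection (hR : Bisimulation R) {X Y : Matrix V V ℝ} (hX : X.IsHermitian)
    (hY : Y.IsHermitian) (h : Compat R X Y) : Compat R (gapProjection X) (gapProjection Y) := by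
  intro u v u' v' r
  have hfin : (spectrum ℝ X).Finite := by
    rw [hX.spectrum_real_eq_range_eigenvalues]; exact Set.finite_range _
  have hS : spectrum ℝ X = hfin.toFinset := by simp
  unfold SpectralGNN.gapProjection
  -- The spectra and gaps coincide, so one interpolation polynomial gives both projections.
  rw [starProjection_eigenspace_eq_aeval hX hS,
    starProjection_eigenspace_eq_aeval hY ((h.spectrum_eq hR).symm.trans hS),
    h.spectralGap_eq hR]
  exact h.aeval hR _ r

/-- Expresses simplicity through the spectrum as a set, which is what a bisimulation preserves. -/
theorem hasSimpleSpectrum_iff_ncard {M : Matrix V V ℝ} (hM : M.IsHermitian) :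
    HasSimpleSpectrum M ↔ (spectrum ℝ M).ncard = Fintype.card V := by
  rw [hM.spectrum_real_eq_range_eigenvalues, ← Set.image_univ]
  have h1 : (Set.univ : Set V).ncard = Fintype.card V := by
    rw [Set.ncard_univ, Nat.card_eq_fintype_card]
  rw [← h1, Set.ncard_image_iff, Set.injOn_univ]
  exact ⟨fun ⟨_, h⟩ => h, fun h => ⟨hM, h⟩⟩

theorem Compat.hasSimpleSpectrum (hR : Bisimulation R) {X Y : Matrix V V ℝ} (hY : Y.IsHermitian)
    (h : Compat R X Y) (hX : HasSimpleSpectrum X) : HasSimpleSpectrum Y := by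
  rw [hasSimpleSpectrum_iff_ncard hY, ← h.spectrum_eq hR]
  exact (hasSimpleSpectrum_iff_ncard hX.1).1 hX

end CompatMatrix

/-! ### Features of graphs related by a bisimulation -/

section GraphFeatures

variable {V : Type*} {R : V → V → V → V → Prop} {G H : SimpleGraph V}

/-- The walk is copied edge by edge: one pebble follows it while the other stays at the endpoint. -/
theorem exists_walk_of_walk (hR : Bisimulation R) (hA : Compat R G.Adj H.Adj) {u v : V}
    (p : G.Walk u v) : ∀ {u' v'}, R u v u' v' → ∃ q : H.Walk u' v', q.length = p.length := by
  induction p with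
  | nil =>
    intro u' v' r
    obtain rfl := (hR.eq_iff r).1 rfl
    exact ⟨.nil, rfl⟩
  | cons h p ih =>
    intro u' v' r
    obtain ⟨π, hπ⟩ := hR.extend r
    obtain ⟨q, hq⟩ := ih (hπ _).2
    exact ⟨.cons ((hA (hπ _).1).mp h) q, congrArg (· + 1) hq⟩

theorem edist_le_of_bisimulation (hR : Bisimulation R) (hA : Compat R G.Adj H.Adj) {u v u' v' : V}
    (r : R u v u' v') : H.edist u' v' ≤ G.edist u v := by
  refine le_iInf fun p => ?_
  obtain ⟨q, hq⟩ := exists_walk_of_walk hR hA p r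
  rw [← hq]
  exact iInf_le (fun w : H.Walk u' v' => (w.length : ℕ∞)) q

theorem Compat.edist (hR : Bisimulation R) (hA : Compat R G.Adj H.Adj) :
    Compat R G.edist H.edist := fun _ _ _ _ r =>
  le_antisymm (edist_le_of_bisimulation hR.flip hA.flip r) (edist_le_of_bisimulation hR hA r)

variable [Fintype V] [DecidableEq V]

omit [Fintype V] [DecidableEq V] in
theorem adjacency_apply (G : SimpleGraph V) (u v : V) [Decidable (G.Adj u v)] :
    adjacency G u v = if G.Adj u v then 1 else 0 := by
  unfold adjacency
  rw [SimpleGraph.adjMatrix_apply]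
  congr

omit [DecidableEq V] in
theorem sum_adjacency (G : SimpleGraph V) (u : V) : ∑ v, adjacency G u v = deg G u := by
  classical
  unfold deg
  simp only [adjacency_apply, Finset.sum_boole]
  rw [← SimpleGraph.card_neighborFinset_eq_degree, SimpleGraph.neighborFinset_eq_filter]

theorem laplacian_apply (G : SimpleGraph V) (u v : V) :
    laplacian G u v = if u = v then (deg G u : ℝ) else -adjacency G u v := by
  unfold laplacian adjacency deg
  rw [SimpleGraph.lapMatrix, SimpleGraph.degMatrix, Matrix.sub_apply]
  split_ifs with h
  · subst h; simp
  · simp [h]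

omit [Fintype V] [DecidableEq V] in
theorem isHermitian_adjacency (G : SimpleGraph V) : (adjacency G).IsHermitian := by
  ext u v
  classical
  simp [adjacency_apply, G.adj_comm]

theorem isHermitian_laplacian (G : SimpleGraph V) : (laplacian G).IsHermitian := by
  ext u v
  classical
  rw [Matrix.conjTranspose_apply, laplacian_apply, laplacian_apply]
  by_cases h : u = v
  · simp [h]
  · simp [h, Ne.symm h, adjacency_apply, G.adj_comm]

theorem isHermitian_normalizedLaplacian (G : SimpleGraph V) :
    (normalizedLaplacian G).IsHermitian := by
  ext u v
  have := (isHermitian_laplacian G).apply u v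
  simp only [star_trivial] at this
  simp [normalizedLaplacian, this, mul_comm]

theorem GraphMatrix.isHermitian (M : GraphMatrix) (G : SimpleGraph V) :
    (M.toMatrix G).IsHermitian := by
  cases M
  exacts [isHermitian_adjacency G, isHermitian_laplacian G, isHermitian_normalizedLaplacian G]

namespace Compat

omit [Fintype V] [DecidableEq V] in
theorem adjacency (hA : Compat R G.Adj H.Adj) : Compat R (adjacency G) (adjacency H) :=
  fun u v u' v' r => by
    classical
    rw [adjacency_apply, adjacency_apply]
    simp only [hA r]

omit [DecidableEq V] in
theorem deg (hR : Bisimulation R) (hA : Compat R G.Adj H.Adj) ⦃v v' : V⦄ (r : R v v v' v') :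
    deg G v = deg H v' := by
  have : (SpectralGNN.deg G v : ℝ) = SpectralGNN.deg H v' := by
    obtain ⟨π, hπ⟩ := hR.extend r
    rw [← sum_adjacency, ← sum_adjacency]
    exact Fintype.sum_equiv π _ _ fun w => hA.adjacency (hπ w).1
  exact_mod_cast this

variable (hR : Bisimulation R) (hA : Compat R G.Adj H.Adj)
include hR hA

theorem laplacian : Compat R (laplacian G) (laplacian H) := fun u v u' v' r => by
  rw [laplacian_apply, laplacian_apply, deg hR hA (hR.diag_left r), hA.adjacency r]
  simp only [hR.eq_iff r]

theorem normalizedLaplacian : Compat R (normalizedLaplacian G) (normalizedLaplacian H) :=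
  fun u v u' v' r => by
    simp only [SpectralGNN.normalizedLaplacian, Matrix.of_apply, laplacian hR hA r,
      deg hR hA (hR.diag_left r), deg hR hA (hR.diag_right r)]

theorem graphMatrix (M : GraphMatrix) : Compat R (M.toMatrix G) (M.toMatrix H) := by
  cases M
  exacts [hA.adjacency, laplacian hR hA, normalizedLaplacian hR hA]

omit [DecidableEq V] in
theorem transition : Compat R (transition G) (transition H) := fun u v u' v' r => by
  simp only [SpectralGNN.transition, Matrix.of_apply, hA.adjacency r, deg hR hA (hR.diag_left r)]

theorem resistance : Compat R (resistance G) (resistance H) := fun u v u' v' r => by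
  have h := ((laplacian hR hA).add (X' := Matrix.of fun _ _ => 1 / (Fintype.card V : ℝ))
    (Y' := Matrix.of fun _ _ => 1 / (Fintype.card V : ℝ)) fun _ _ _ _ _ => rfl).inv hR
  simp only [SpectralGNN.resistance, h r, h (hR.diag_left r), h (hR.diag_right r)]

/-- Away from the target, a time step is a product with the transition matrix; the target itself is
recognized because equality is preserved. -/
theorem survival (k : ℕ) :
    Compat R (fun u v => survival G v k u) (fun u v => survival H v k u) := by
  induction k with
  | zero => exact fun u v u' v' r => by simp only [SpectralGNN.survival, hR.eq_iff r]
  | succ k ih =>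
    intro u v u' v' r
    simp only [SpectralGNN.survival, hR.eq_iff r]
    exact congrArg (fun x => if u' = v' then 0 else x) ((transition hR hA).sum_mul hR ih r)

theorem hittingTime : Compat R (hittingTime G) (hittingTime H) := fun u v u' v' r => by
  unfold SpectralGNN.hittingTime
  exact tsum_congr fun k => congrArg ENNReal.ofReal (survival hR hA k r)

theorem commuteTime : Compat R (commuteTime G) (commuteTime H) := fun u v u' v' r => by
  unfold SpectralGNN.commuteTime
  rw [hittingTime hR hA r, hittingTime hR hA (hR.swap r)]

theorem pageRank (γ : ℕ → ℝ) : Compat R (pageRank γ G) (pageRank γ H) := fun u v u' v' r => by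
  unfold SpectralGNN.pageRank
  exact tsum_congr fun k => by rw [(transition hR hA).pow hR k r]

theorem distance : Compat R (GraphormerGD.distance G) (GraphormerGD.distance H) :=
  (Compat.edist hR hA).map₂ (resistance hR hA) Prod.mk

theorem prdFeature (γ : ℕ → ℝ) : Compat R (prdFeature γ G) (prdFeature γ H) :=
  hA.adjacency.map₂ (pageRank hR hA γ) Prod.mk

theorem diffWireFeature : Compat R (diffWireFeature G) (diffWireFeature H) :=
  fun u v u' v' r => by
    have hL := laplacian hR hA
    have hN := normalizedLaplacian hR hA
    unfold SpectralGNN.diffWireFeature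
    rw [hA.adjacency r, commuteTime hR hA r, hL.spectralGap_eq hR, hN.spectralGap_eq hR,
      hL.gapProjection hR (isHermitian_laplacian G) (isHermitian_laplacian H) r,
      hN.gapProjection hR (isHermitian_normalizedLaplacian G)
        (isHermitian_normalizedLaplacian H) r]

theorem randomWalkFeature : Compat R (randomWalkFeature G) (randomWalkFeature H) :=
  fun u v u' v' r => by
    unfold SpectralGNN.randomWalkFeature
    rw [hA.adjacency r, hittingTime hR hA r, hittingTime hR hA (hR.swap r),
      commuteTime hR hA r, resistance hR hA r]
    simp only [(transition hR hA).pow hR _ r]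

end Compat

end GraphFeatures

/-! ### Networks on graphs related by a bisimulation -/

section Networks

variable {V : Type*} [Fintype V] {R : V → V → V → V → Prop}

namespace PairGNN

variable {α : Type} (N : PairGNN α) {d d' : V → V → α}

theorem hidden_eq (hR : Bisimulation R) (hd : Compat R d d') (t : ℕ) :
    ∀ ⦃v v'⦄, R v v v' v' → N.hidden d t v = N.hidden d' t v' := by
  induction t with
  | zero => exact fun v v' r => congrArg N.init (hd r)
  | succ t ih =>
    intro v v' r
    obtain ⟨π, hπ⟩ := hR.extend_diag r
    exact congrArg₂ (N.update t) (ih r) <| map_univ_val_eq_of_perm π fun w => by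
      rw [ih (hπ w).2, hd (hπ w).1]

theorem eval_eq (hR : Bisimulation R) (hd : Compat R d d') : N.eval d = N.eval d' := by
  obtain ⟨π, hπ⟩ := hR.exists_perm_diag
  exact congrArg N.readout <| map_univ_val_eq_of_perm π fun w => N.hidden_eq hR hd _ (hπ w)

end PairGNN

theorem softmax_apply_eq {S T : Matrix V V ℝ} {v v' : V} (π : Equiv.Perm V)
    (h : ∀ w, S v w = T v' (π w)) (w : V) : softmax S v w = softmax T v' (π w) := by
  simp only [softmax, Matrix.of_apply, h w]
  rw [Fintype.sum_equiv π (fun w => Real.exp (S v w)) (fun w => Real.exp (T v' w))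
    fun w => by rw [h w]]

namespace GraphormerGD

variable [DecidableEq V] (N : GraphormerGD) {G H : SimpleGraph V}

/-- One bijection matches the row of `v` with the row of `v'`, hence also the softmax
normalizations, and it sends each vertex to one with the same features. -/
theorem attention_eq (hR : Bisimulation R) (hA : Compat R G.Adj H.Adj) (t : ℕ)
    {X Y : Matrix V (Fin N.width) ℝ} (hX : ∀ ⦃v v'⦄, R v v v' v' → X v = Y v') ⦃v v' : V⦄
    (r : R v v v' v') : N.attention G t X v = N.attention H t Y v' := by
  have hd := Compat.distance hR hA
  obtain ⟨π, hπ⟩ := hR.extend_diag r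
  have hmul : ∀ {k : ℕ} (W : Matrix (Fin N.width) (Fin k) ℝ) {w w' : V}, R w w w' w' →
      (X * W) w = (Y * W) w' := fun W w w' s => by
    funext j
    simp only [Matrix.mul_apply, hX s]
  have hS : ∀ h w, ((X * N.query t h) * (X * N.key t h).transpose +
        Matrix.of fun u v => N.φ₂ t h (distance G u v)) v w =
      ((Y * N.query t h) * (Y * N.key t h).transpose +
        Matrix.of fun u v => N.φ₂ t h (distance H u v)) v' (π w) := fun h w => by
    rw [Matrix.add_apply, Matrix.add_apply, Matrix.mul_apply, Matrix.mul_apply,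
      Matrix.of_apply, Matrix.of_apply, hd (hπ w).1]
    simp only [Matrix.transpose_apply, hmul _ r, hmul _ (hπ w).2]
  funext j
  simp only [attention, Matrix.sum_apply]
  refine Finset.sum_congr rfl fun h _ => ?_
  rw [Matrix.mul_assoc (Matrix.hadamard _ _), Matrix.mul_assoc (Matrix.hadamard _ _),
    Matrix.mul_apply, Matrix.mul_apply]
  refine Fintype.sum_equiv π _ _ fun w => ?_
  have hV : (X * N.value t h * N.proj t h) w j = (Y * N.value t h * N.proj t h) (π w) j := by
    rw [Matrix.mul_assoc, Matrix.mul_assoc]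
    exact congrFun (hmul _ (hπ w).2) j
  rw [hV, Matrix.hadamard_apply, Matrix.hadamard_apply, softmax_apply_eq π (hS h),
    Matrix.of_apply, Matrix.of_apply, hd (hπ w).1]

theorem hidden_eq (hR : Bisimulation R) (hA : Compat R G.Adj H.Adj) (t : ℕ) :
    ∀ ⦃v v'⦄, R v v v' v' → N.hidden G t v = N.hidden H t v' := by
  induction t with
  | zero => exact fun v v' r => congrArg N.embed (Compat.deg hR hA r)
  | succ t ih =>
    exact fun v v' r => congrArg₂ (N.feedForward t) (ih r) (N.attention_eq hR hA t ih r)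

theorem eval_eq (hR : Bisimulation R) (hA : Compat R G.Adj H.Adj) : N.eval G = N.eval H := by
  obtain ⟨π, hπ⟩ := hR.exists_perm_diag
  exact congrArg N.readout <| map_univ_val_eq_of_perm π fun w => N.hidden_eq hR hA _ (hπ w)

end GraphormerGD

end Networks

/-! ### A criterion for simple spectrum -/

section Krylov

open Matrix

variable {V : Type*} [Fintype V] [DecidableEq V]

/-- A symmetric matrix with a cyclic vector has simple spectrum. -/
theorem hasSimpleSpectrum_of_cyclic {M : Matrix V V ℝ} (hM : M.IsHermitian) (x : ℕ → V → ℝ)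
    (c : ℝ) (hx : ∀ k, x (k + 1) = c • (M *ᵥ x k))
    (hspan : ∀ z : V → ℝ, (∀ k, z ⬝ᵥ x k = 0) → z = 0) : HasSimpleSpectrum M := by
  have hT : Mᵀ = M := by simpa using hM.eq
  -- By symmetry of `M`, an eigenvector orthogonal to `x 0` is orthogonal to the whole Krylov
  -- sequence.
  have key : ∀ (z : V → ℝ) (μ : ℝ), M *ᵥ z = μ • z → z ⬝ᵥ x 0 = 0 → z = 0 := by
    intro z μ hz h0
    refine hspan z fun k => ?_
    induction k with
    | zero => exact h0
    | succ k ih =>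
      have hzM : z ᵥ* M = μ • z := by rw [← hz, ← mulVec_transpose, hT]
      rw [hx, dotProduct_smul, dotProduct_mulVec, hzM, smul_dotProduct, ih, smul_zero, smul_zero]
  refine ⟨hM, fun i j hij => by_contra fun hne => ?_⟩
  set b : V → V → ℝ := fun i => (hM.eigenvectorBasis i).ofLp
  have hb : ∀ i, M *ᵥ b i = hM.eigenvalues i • b i := hM.mulVec_eigenvectorBasis
  have hinner : ∀ i j, b i ⬝ᵥ b j = if j = i then 1 else 0 := fun i j => by
    rw [← orthonormal_iff_ite.1 hM.eigenvectorBasis.orthonormal j i,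
      EuclideanSpace.inner_eq_star_dotProduct]
    simp [b]
  -- With a repeated eigenvalue, this combination is an eigenvector orthogonal to `x 0`, so it
  -- vanishes. Pairing with `b i` gives `b j ⬝ᵥ x 0 = 0`, so `key` also kills `b j`.
  have hz := key ((b j ⬝ᵥ x 0) • b i - (b i ⬝ᵥ x 0) • b j) (hM.eigenvalues i)
    (by rw [mulVec_sub, mulVec_smul, mulVec_smul, hb, hb, ← hij]; module)
    (by simp only [sub_dotProduct, smul_dotProduct, smul_eq_mul]; ring)
  have h1 := congrArg (· ⬝ᵥ b i) hz
  simp only [sub_dotProduct, smul_dotProduct, hinner, if_neg hne, if_true, mul_zero, sub_zero,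
    zero_dotProduct, smul_eq_mul, mul_one] at h1
  have h2 := hinner j j
  rw [key (b j) _ (hb j) h1, zero_dotProduct, if_pos rfl] at h2
  exact zero_ne_one h2

/-- A symmetric matrix `M` has simple spectrum if a multiple of `M` is similar, by a diagonal
matrix, to an integer matrix `N` that has a cyclic vector modulo `p`. -/
theorem hasSimpleSpectrum_of_krylov {n p : ℕ} [NeZero n] [Nontrivial (ZMod p)]
    {M : Matrix (Fin n) (Fin n) ℝ} (hM : M.IsHermitian) (b : Fin n → ℝ) (hb : ∀ i, b i ≠ 0) (c : ℝ)
    (N : Matrix (Fin n) (Fin n) ℤ) (hMN : ∀ i j, c * (M i j * b j) = b i * N i j)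
    (K W : Matrix (Fin n) (Fin n) (ZMod p))
    (hK : ∀ k : ℕ, ∀ hk : k + 1 < n, ∀ i,
      K ⟨k + 1, hk⟩ i = ∑ j, (N i j : ZMod p) * K ⟨k, by omega⟩ j)
    (hW : W * K = 1) : HasSimpleSpectrum M := by
  -- The first row is lifted to the integers; the integral Krylov matrix then reduces to `K` modulo
  -- `p`, and a determinant that is nonzero modulo `p` is nonzero.
  obtain ⟨y₀, hy₀⟩ : ∃ y₀ : Fin n → ℤ, ∀ i, (y₀ i : ZMod p) = K 0 i :=
    ⟨fun i => (ZMod.intCast_surjective (K 0 i)).choose,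
      fun i => (ZMod.intCast_surjective (K 0 i)).choose_spec⟩
  set y : ℕ → Fin n → ℤ := fun k => (fun v => N *ᵥ v)^[k] y₀ with hy
  have hysucc : ∀ k, y (k + 1) = N *ᵥ y k := fun k => Function.iterate_succ_apply' _ _ _
  have hyK : ∀ k : ℕ, ∀ hk : k < n, ∀ i, (y k i : ZMod p) = K ⟨k, hk⟩ i := by
    intro k
    induction k with
    | zero => exact fun _ i => hy₀ i
    | succ k ih =>
      intro hk i
      rw [hK k hk, hysucc, mulVec, dotProduct, Int.cast_sum]
      exact Finset.sum_congr rfl fun j _ => by rw [Int.cast_mul, ih]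
  set Y : Matrix (Fin n) (Fin n) ℤ := Matrix.of fun k i => y k i
  have hYK : Y.map (Int.castRingHom (ZMod p)) = K := by
    ext k i
    exact hyK k k.2 i
  have hdet : Y.det ≠ 0 := fun h0 => by
    have h1 : K.det = 0 := by
      rw [← hYK, ← RingHom.mapMatrix_apply, ← RingHom.map_det, h0, map_zero]
    have h2 := congrArg Matrix.det hW
    rw [det_mul, h1, mul_zero, det_one] at h2
    exact zero_ne_one h2
  have hdetR : (Y.map (Int.castRingHom ℝ)).det ≠ 0 := by
    rw [← RingHom.mapMatrix_apply, ← RingHom.map_det]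
    simpa using hdet
  refine hasSimpleSpectrum_of_cyclic hM (fun k i => b i * y k i) c (fun k => ?_) fun z hz => ?_
  · funext i
    simp only [hysucc, Pi.smul_apply, smul_eq_mul, mulVec, dotProduct, Int.cast_sum, Int.cast_mul,
      Finset.mul_sum]
    refine Finset.sum_congr rfl fun j _ => ?_
    linear_combination (-(y k j : ℝ)) * hMN i j
  · have h0 : Y.map (Int.castRingHom ℝ) *ᵥ (fun i => b i * z i) = 0 := by
      funext k
      have := hz k
      simp only [dotProduct] at this
      simp only [mulVec, dotProduct, Matrix.map_apply, Pi.zero_apply]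
      rw [← this]
      exact Finset.sum_congr rfl fun i _ => by simp [Y]; ring
    funext i
    have h3 := congrFun (eq_zero_of_mulVec_eq_zero hdetR h0) i
    exact (mul_eq_zero.1 h3).resolve_left (hb i)

end Krylov

/-! ### Permutations from equal sums of powers -/

/-- Fewer than `B` summands produce no carries in base `B`, so the digit at place `c` counts the
indices with value `c`. One number thus encodes the multiset of values. -/
theorem sum_pow_div_pow_mod {ι : Type*} [Fintype ι] {B : ℕ} (hB : Fintype.card ι < B) (f : ι → ℕ)
    (c : ℕ) : (∑ i, B ^ f i) / B ^ c % B = (Finset.univ.filter fun i => f i = c).card := by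
  have hB0 : 0 < B := by omega
  have hcard : ∀ s : Finset ι, s.card < B := fun s => (Finset.card_le_univ s).trans_lt hB
  have hlow : ∑ i with f i < c, B ^ f i < B ^ c := by
    rcases c with - | c
    · simp
    · calc ∑ i with f i < c + 1, B ^ f i
          ≤ ∑ i with f i < c + 1, B ^ c := Finset.sum_le_sum fun i hi =>
            Nat.pow_le_pow_right hB0 (Nat.lt_succ_iff.1 (Finset.mem_filter.1 hi).2)
        _ < B ^ (c + 1) := by
            rw [Finset.sum_const, smul_eq_mul, pow_succ, mul_comm]
            exact Nat.mul_lt_mul_of_pos_left (hcard _) (pow_pos hB0 c)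
  obtain ⟨q, hq⟩ : B ^ (c + 1) ∣ ∑ i with ¬ f i < c ∧ f i ≠ c, B ^ f i :=
    Finset.dvd_sum fun i hi => pow_dvd_pow B (by have := (Finset.mem_filter.1 hi).2; omega)
  have hmid : ∑ i with ¬ f i < c ∧ f i = c, B ^ f i =
      (Finset.univ.filter fun i => f i = c).card * B ^ c := by
    rw [← smul_eq_mul, ← Finset.sum_const]
    refine Finset.sum_congr (Finset.filter_congr fun i _ => by omega) fun i hi => ?_
    rw [(Finset.mem_filter.1 hi).2]
  have hsum : ∑ i, B ^ f i = ∑ i with f i < c, B ^ f i +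
      B ^ c * ((Finset.univ.filter fun i => f i = c).card + B * q) := by
    rw [← Finset.sum_filter_add_sum_filter_not Finset.univ (fun i => f i < c),
      ← Finset.sum_filter_add_sum_filter_not (Finset.univ.filter fun i => ¬ f i < c)
        (fun i => f i = c), Finset.filter_filter, Finset.filter_filter, hmid, hq]
    ring
  rw [hsum, Nat.add_mul_div_left _ _ (pow_pos hB0 c), Nat.div_eq_of_lt hlow, zero_add,
    Nat.add_mul_mod_self_left, Nat.mod_eq_of_lt (hcard _)]

theorem exists_perm_of_sum_pow_eq {ι : Type*} [Fintype ι] {B : ℕ} (hB : Fintype.card ι < B)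
    {f g : ι → ℕ} (h : ∑ i, B ^ f i = ∑ i, B ^ g i) : ∃ π : Equiv.Perm ι, ∀ i, f i = g (π i) :=
  exists_perm_of_card_fiber_eq fun c => by
    rw [← sum_pow_div_pow_mod hB f c, ← sum_pow_div_pow_mod hB g c, h]

/-! ### Two graphs that are not isomorphic, but related by a bisimulation -/

namespace Twist

/-- The parity of the two lowest bits of a number. -/
def parity (a : ℕ) : ℕ := (a.testBit 0 ^^ a.testBit 1).toNat

/-- The vertex `u` lies in the fiber `u / 4`, at the position `u % 4`, which is viewed as an
element of `(ℤ/2)²`. The class of a pair of vertices is its orbit under the translations of the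
two fibers by automorphisms; it depends on `t` for the fibers `2` and `3`. -/
def pairClass (t u v : ℕ) : ℕ :=
  let i := u / 4
  let j := v / 4
  let p := (u % 4) ^^^ (v % 4)
  if i = j then p
  else if i < 4 ∧ j < 4 then
    (parity (p &&& (i ^^^ j)) + if 2 ≤ i ∧ 2 ≤ j then t else 0) % 2
  else if i < 2 ∨ j < 2 then parity (p &&& 1)
  else 0

/-- The color of a pair of vertices: the two fibers, and the class of the pair. -/
def color (t u v : ℕ) : ℕ := (u / 4 * 5 + v / 4) * 4 + pairClass t u v

/-- The differences of the pairs of neighbors in a fiber. -/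
def differences : ℕ → List ℕ
  | 0 => [1, 2]
  | 1 => [1, 2, 3]
  | 2 => [2]
  | 3 => [2, 3]
  | _ => []

/-- Whether the pairs of a given color are adjacent. -/
def adjColor (c : ℕ) : Bool :=
  let i := c / 20
  let j := c / 4 % 5
  if i = j then (differences i).contains (c % 4)
  else if i = 4 ∨ j = 4 then i == 1 || j == 1 || ((i == 0 || j == 0) && c % 4 == 0)
  else c % 4 == 0

/-- Adjacency in the graph with parameter `t`. -/
def adj (t u v : ℕ) : Bool := adjColor (color t u v)

/-- The degree of a vertex. -/
def degree (u : ℕ) : ℕ := [9, 11, 7, 8, 6].getD (u / 4) 0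

/-- The fiber of `w` and the classes of the pairs `(u, w)` and `(w, v)`, in one number. -/
def triangleClass (t u v w : ℕ) : ℕ := w / 4 * 16 + pairClass t u w * 4 + pairClass t w v

/-! ### Finite combinatorics of the twisted pair -/

theorem adj_symm : ∀ t : Fin 2, ∀ u v : Fin 18, adj t u v = true → adj t v u = true := by
  decide +kernel

theorem adj_irrefl : ∀ t : Fin 2, ∀ u : Fin 18, adj t u u = false := by decide +kernel

theorem card_adj : ∀ t : Fin 2, ∀ u : Fin 18,
    (Finset.univ.filter fun v : Fin 18 => adj t u v = true).card = degree u := by decide +kernel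

/-- Gives connectedness by descent to the vertex `0`. -/
theorem exists_adj_lt : ∀ t : Fin 2, ∀ u : Fin 18, u ≠ 0 →
    ∃ v : Fin 18, v < u ∧ adj t u v = true := by decide +kernel

theorem pairClass_lt : ∀ t : Fin 2, ∀ u v : Fin 18, pairClass t u v < 4 := by decide +kernel

/-- For `u`, `v`, `w` in three different large fibers, the functionals at `w` are independent, so
every pair of classes occurs exactly once whatever the twist. If two of the three share a fiber, the
class of `(u, v)` determines the counts. The small fiber reads the same low bit that joins fibers 0
and 1. -/
theorem pairClass_eq : ∀ u u' : Fin 18, (u / 4 : ℕ) = u' / 4 → ∀ v v' : Fin 18,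
    (v / 4 : ℕ) = v' / 4 → pairClass 0 u v = pairClass 1 u' v' →
    ∑ w : Fin 18, 32 ^ triangleClass 0 u v w = ∑ w : Fin 18, 32 ^ triangleClass 1 u' v' w ∧
      pairClass 0 v u = pairClass 1 v' u' ∧ (u = v ↔ u' = v') := by decide +kernel

theorem fibers_eq {u v u' v' : Fin 18} (h : color 0 u v = color 1 u' v') :
    (u / 4 : ℕ) = u' / 4 ∧ (v / 4 : ℕ) = v' / 4 ∧ pairClass 0 u v = pairClass 1 u' v' := by
  have h1 : pairClass 0 u v < 4 := pairClass_lt 0 u v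
  have h2 : pairClass 1 u' v' < 4 := pairClass_lt 1 u' v'
  unfold color at h
  omega

theorem exists_clique : ∃ a b c d : Fin 18,
    (degree a = 9 ∧ degree b = 11 ∧ degree c = 7 ∧ degree d = 8) ∧
    (adj 0 a b ∧ adj 0 a c ∧ adj 0 b c) ∧ adj 0 a d ∧ adj 0 b d ∧ adj 0 c d :=
  ⟨0, 4, 8, 12, by decide +kernel⟩

/-- The degrees put one vertex in each large fiber. Adding the six edge conditions, each position is
hit by all three nonzero functionals, whose sum is zero; what remains is `0 = t`. -/
theorem not_exists_clique : ∀ a : Fin 18, degree a = 9 → ∀ b : Fin 18, degree b = 11 →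
    adj 1 a b → ∀ c : Fin 18, degree c = 7 → adj 1 a c → adj 1 b c →
    ∀ d : Fin 18, degree d = 8 → adj 1 a d → adj 1 b d → ¬ adj 1 c d := by
  decide +kernel

/-! Krylov bases modulo 7 and 13, as lists of hexadecimal digits, and their inverses. -/

def adjacencyKrylov : List ℕ :=
  [0x020416523506643360, 0x453133053163560610, 0x054040651112415223, 0x161362404525503354,
   0x652040552231612353, 0x436230305301630500, 0x315526135536503125, 0x563033535311631513,
   0x651601051065464462, 0x365600134414355511, 0x552424461310401366, 0x505435353662320063,
   0x524550564311213151, 0x606164512514551110, 0x322253106640322260, 0x340533243315513031,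
   0x460151435466520061, 0x460322436635201032]

def adjacencyKrylovInverse : List ℕ :=
  [0x334245326443264260, 0x503265042055604450, 0x362544156663012252, 0x652310046152541211,
   0x360602340621410634, 0x054263554056465125, 0x501555031455161025, 0x501405143610510206,
   0x222201105065626506, 0x211233626264240235, 0x366126142156263133, 0x525416514333256334,
   0x365160312214154255, 0x204346636216304150, 0x100520041550336241, 0x235635162461001425,
   0x655334014004021650, 0x032414623232544416]

def laplacianKrylov : List ℕ :=
  [0x3877c380b63a608a00, 0x461c83528393896b9a, 0x6c891c97c675832c0b, 0xb059c358369c891a33,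
   0xb15951c7cb4547c542, 0x450483828421133b56, 0x9609b18013a4664751, 0x62c57545b2b2903142,
   0x70c3a298b87a419565, 0x577735828b88c98333, 0x8c5067acc134106b15, 0x7907801205b15a9565,
   0x0445493807925156a9, 0x754bb2542b1a35407c, 0xccb3c1801944113b1a, 0x62687907c454c54760,
   0x05720061a1b00c409a, 0x3a2762b0c1a7082c47]

def laplacianKrylovInverse : List ℕ :=
  [0x05a13855395a8126c6, 0x8a452051b84ca06616, 0x136b0a2b3c12b09ba6, 0x6a725228a560b1b986,
   0x8150b98144122a6676, 0xc9596508a431825836, 0xaa31172b5b44537c26, 0x759770b1a87b399526,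
   0xc81000576553b78676, 0x2bb9b056967c01c4b6, 0x86b4b38aba7bbab2a6, 0x7171c020093b2c3906,
   0x5ab605cb2c4c2894b6, 0x640838ac30586c7b86, 0xabba7c77a6b724c646, 0x7290701aa5c6b214b6,
   0x76000a0a70a3626236, 0x0106c19094a9b17b76]

def normalizedKrylov : List ℕ :=
  [0x37096879443a868bb5, 0xbc4178286a380584bb, 0x527413a913091b102c, 0x65b7583a979289342c,
   0x3c5a0138689951c478, 0x1a765c3681670a38a4, 0x9c6b420868260a0c7a, 0x3670b81947b8384101,
   0xa461990731cc074018, 0xbb3a89242c2c037002, 0x38b277b90b48c4443c, 0x94a8a39bc3889c3b30,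
   0xb242b2374b95484178, 0x3398c276153202538a, 0xbb31b1c92450b67382, 0x301bc353745a6209c4,
   0x93433b191ca5c0c175, 0x8b1767b6404698c965]

def normalizedKrylovInverse : List ℕ :=
  [0x2927908864c3b7293a, 0x45100432c90159543a, 0x848a55107acab1011a, 0x5bb78943c3b7a208aa,
   0x108549351280c02aa5, 0x2b8b1a1717549c0675, 0xba47831536b79bb735, 0xc70942c1cb6b913135,
   0x96ba4923c672598792, 0xc18282b0477cb4c512, 0x67bca90c980006c502, 0x28c385637835a5b172,
   0x4c8857b3c8b0895566, 0x2876a88b48a77cb506, 0x6c4896a161bb371c26, 0x0bbcc5c55a1b745856,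
   0x2652998536c94b861b, 0xc579527b5c25a8684b]

/-- The matrix modulo `p` with the given hexadecimal digits. -/
def digitMatrix (p : ℕ) (T : List ℕ) : Matrix (Fin 18) (Fin 18) (ZMod p) :=
  Matrix.of fun i j => ((T.getD i 0 >>> (4 * (j : ℕ)) % 16 : ℕ) : ZMod p)

/-- The adjacency matrix, over the integers. -/
def intAdjacency : Matrix (Fin 18) (Fin 18) ℤ := Matrix.of fun i j => if adj 0 i j then 1 else 0

/-- The Laplacian, over the integers. -/
def intLaplacian : Matrix (Fin 18) (Fin 18) ℤ := Matrix.of fun i j =>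
  if i = j then (degree i : ℤ) else -intAdjacency i j

/-- An integer multiple of the random walk Laplacian. -/
def intNormalized : Matrix (Fin 18) (Fin 18) ℤ := Matrix.of fun i j =>
  (5544 / degree i : ℕ) * intLaplacian i j

/-! ### Certificates for cyclic vectors -/

theorem adjacency_krylov : ∀ k : ℕ, ∀ hk : k + 1 < 18, ∀ i,
    digitMatrix 7 adjacencyKrylov ⟨k + 1, hk⟩ i =
      ∑ j, (intAdjacency i j : ZMod 7) * digitMatrix 7 adjacencyKrylov ⟨k, by omega⟩ j := by
  have h : ∀ k : Fin 17, ∀ i, digitMatrix 7 adjacencyKrylov k.succ i =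
      ∑ j, (intAdjacency i j : ZMod 7) * digitMatrix 7 adjacencyKrylov k.castSucc j := by
    decide +kernel
  exact fun k hk i => h ⟨k, by omega⟩ i

theorem adjacency_inverse :
    digitMatrix 7 adjacencyKrylovInverse * digitMatrix 7 adjacencyKrylov = 1 := by
  ext i j
  rw [Matrix.mul_apply, Matrix.one_apply]
  revert i j
  decide +kernel

theorem laplacian_krylov : ∀ k : ℕ, ∀ hk : k + 1 < 18, ∀ i,
    digitMatrix 13 laplacianKrylov ⟨k + 1, hk⟩ i =
      ∑ j, (intLaplacian i j : ZMod 13) * digitMatrix 13 laplacianKrylov ⟨k, by omega⟩ j := by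
  have h : ∀ k : Fin 17, ∀ i, digitMatrix 13 laplacianKrylov k.succ i =
      ∑ j, (intLaplacian i j : ZMod 13) * digitMatrix 13 laplacianKrylov k.castSucc j := by
    decide +kernel
  exact fun k hk i => h ⟨k, by omega⟩ i

theorem laplacian_inverse :
    digitMatrix 13 laplacianKrylovInverse * digitMatrix 13 laplacianKrylov = 1 := by
  ext i j
  rw [Matrix.mul_apply, Matrix.one_apply]
  revert i j
  decide +kernel

theorem normalized_krylov : ∀ k : ℕ, ∀ hk : k + 1 < 18, ∀ i,
    digitMatrix 13 normalizedKrylov ⟨k + 1, hk⟩ i =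
      ∑ j, (intNormalized i j : ZMod 13) * digitMatrix 13 normalizedKrylov ⟨k, by omega⟩ j := by
  have h : ∀ k : Fin 17, ∀ i, digitMatrix 13 normalizedKrylov k.succ i =
      ∑ j, (intNormalized i j : ZMod 13) * digitMatrix 13 normalizedKrylov k.castSucc j := by
    decide +kernel
  exact fun k hk i => h ⟨k, by omega⟩ i

theorem normalized_inverse :
    digitMatrix 13 normalizedKrylovInverse * digitMatrix 13 normalizedKrylov = 1 := by
  ext i j
  rw [Matrix.mul_apply, Matrix.one_apply]
  revert i j
  decide +kernel

/-- The two graphs. -/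
def graph (t : Fin 2) : SimpleGraph (Fin 18) where
  Adj u v := adj t u v = true
  symm := ⟨adj_symm t⟩
  loopless := ⟨fun u h => by simp [adj_irrefl t u] at h⟩

theorem connected_graph (t : Fin 2) : (graph t).Connected := by
  have h : ∀ u, (graph t).Reachable u 0 := fun u => by
    induction u using WellFoundedLT.induction with
    | ind u ih =>
      by_cases hu : u = 0
      · exact hu ▸ .refl _
      · obtain ⟨v, hv, ha⟩ := exists_adj_lt t u hu
        exact (SimpleGraph.Adj.reachable (G := graph t) ha).trans (ih v hv)
  exact ⟨fun u v => (h u).trans (h v).symm⟩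

theorem deg_graph (t : Fin 2) (u : Fin 18) : deg (graph t) u = degree u := by
  rw [← card_adj t u]
  unfold deg
  rw [← SimpleGraph.card_neighborFinset_eq_degree, SimpleGraph.neighborFinset_eq_filter]
  congr

/-- Two pairs of vertices are related if they have the same color in the respective graphs. -/
def SameColor (u v u' v' : Fin 18) : Prop := color 0 u v = color 1 u' v'

theorem bisimulation : Bisimulation SameColor where
  extend {u v u' v'} h := by
    obtain ⟨hu, hv, hc⟩ := fibers_eq h
    -- The base 32 exceeds the number 18 of vertices.
    obtain ⟨π, hπ⟩ := exists_perm_of_sum_pow_eq (B := 32) (by simp)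
      (pairClass_eq u u' hu v v' hv hc).1
    refine ⟨π, fun w => ?_⟩
    have h0 := hπ w
    have h1 : pairClass 0 u w < 4 := pairClass_lt 0 u w
    have h2 : pairClass 0 w v < 4 := pairClass_lt 0 w v
    have h3 : pairClass 1 u' (π w) < 4 := pairClass_lt 1 u' (π w)
    have h4 : pairClass 1 (π w) v' < 4 := pairClass_lt 1 (π w) v'
    unfold triangleClass at h0
    unfold SameColor color
    omega
  swap {u v u' v'} h := by
    obtain ⟨hu, hv, hc⟩ := fibers_eq h
    unfold SameColor color
    rw [hu, hv, (pairClass_eq u u' hu v v' hv hc).2.1]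
  eq_iff {u v u' v'} h := by
    obtain ⟨hu, hv, hc⟩ := fibers_eq h
    exact (pairClass_eq u u' hu v v' hv hc).2.2
  nonempty := ⟨0, 0, 0, 0, by unfold SameColor; decide +kernel⟩

theorem compat_adj : Compat SameColor (graph 0).Adj (graph 1).Adj := fun u v u' v' h => by
  change (adjColor (color 0 u v) = true) = (adjColor (color 1 u' v') = true)
  rw [show color 0 u v = color 1 u' v' from h]

theorem not_nonempty_iso : ¬ Nonempty (graph 0 ≃g graph 1) := by
  rintro ⟨e⟩
  obtain ⟨a, b, c, d, ⟨ha, hb, hc, hd⟩, ⟨hab, hac, hbc⟩, had, hbd, hcd⟩ := exists_clique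
  have he : ∀ {u v : Fin 18}, adj 0 u v = true → adj 1 (e u) (e v) = true := fun {u v} h =>
    e.map_adj_iff.2 (show (graph 0).Adj u v from h)
  have hdeg : ∀ u, degree (e u) = degree u := fun u => by
    classical
    rw [← deg_graph 1, ← deg_graph 0]
    unfold deg
    convert e.degree_eq u
  exact not_exists_clique (e a) (by rw [hdeg, ha]) (e b) (by rw [hdeg, hb]) (he hab) (e c)
    (by rw [hdeg, hc]) (he hac) (he hbc) (e d) (by rw [hdeg, hd]) (he had) (he hbd) (he hcd)

theorem adjacency_graph (u v : Fin 18) : adjacency (graph 0) u v = intAdjacency u v := by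
  classical
  have h : (graph 0).Adj u v ↔ adj 0 u v = true := Iff.rfl
  rw [adjacency_apply]
  simp [h, intAdjacency]

theorem laplacian_graph (u v : Fin 18) : laplacian (graph 0) u v = intLaplacian u v := by
  rw [laplacian_apply, adjacency_graph, deg_graph]
  simp only [intLaplacian, Matrix.of_apply]
  split_ifs <;> simp

/-- 5544 is the least common multiple of the degrees 9, 11, 7, 8, 6, so it clears the denominators
of `D⁻¹ L`. -/
theorem degree_mul_div : ∀ u : Fin 18, 0 < degree u ∧ degree u * (5544 / degree u) = 5544 := by
  decide +kernel

theorem hasSimpleSpectrum_graph (M : GraphMatrix) : HasSimpleSpectrum (M.toMatrix (graph 0)) := by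
  have hM := M.isHermitian (graph 0)
  have : Fact (1 < 7) := ⟨by norm_num⟩
  have : Fact (1 < 13) := ⟨by norm_num⟩
  cases M with
  | adjacency =>
    refine hasSimpleSpectrum_of_krylov hM (fun _ => 1) (fun _ => one_ne_zero) 1 intAdjacency
      (fun i j => ?_) _ _ adjacency_krylov adjacency_inverse
    rw [one_mul, one_mul, mul_one]
    exact adjacency_graph i j
  | laplacian =>
    refine hasSimpleSpectrum_of_krylov hM (fun _ => 1) (fun _ => one_ne_zero) 1 intLaplacian
      (fun i j => ?_) _ _ laplacian_krylov laplacian_inverse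
    rw [one_mul, one_mul, mul_one]
    exact laplacian_graph i j
  | normalizedLaplacian =>
    have hpos : ∀ i : Fin 18, 0 < √(degree i : ℝ) := fun i =>
      Real.sqrt_pos.2 (by exact_mod_cast (degree_mul_div i).1)
    -- Conjugation by `D^(1/2)` turns the normalized Laplacian into `D⁻¹ L`.
    refine hasSimpleSpectrum_of_krylov hM (fun i => √(degree i : ℝ)) (fun i => (hpos i).ne') 5544
      intNormalized (fun i j => ?_) _ _ normalized_krylov normalized_inverse
    have h1 : (degree i : ℝ) * (5544 / degree i : ℕ) = 5544 := by
      exact_mod_cast (degree_mul_div i).2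
    have h2 : √(degree i : ℝ) * √(degree i : ℝ) = degree i := Real.mul_self_sqrt (by positivity)
    have hi := hpos i
    have hj := hpos j
    simp only [GraphMatrix.toMatrix, normalizedLaplacian, intNormalized, Matrix.of_apply,
      laplacian_graph, deg_graph, Int.cast_mul, Int.cast_natCast]
    rw [← h2] at h1
    rw [← h1]
    field_simp

theorem mem_simpleSpectrumGraphs (M : GraphMatrix) (t : Fin 2) :
    graph t ∈ simpleSpectrumGraphs M 18 := by
  refine ⟨connected_graph t, ?_⟩
  obtain rfl | rfl : t = 0 ∨ t = 1 := by omega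
  · exact hasSimpleSpectrum_graph M
  -- No second certificate is needed: the twisted graph has the same spectrum.
  · exact (Compat.graphMatrix bisimulation compat_adj M).hasSimpleSpectrum bisimulation
      (M.isHermitian _) (hasSimpleSpectrum_graph M)

/-- A family of functions that do not separate the two graphs is not complete. -/
theorem not_isComplete (M : GraphMatrix) {Θ : Type*} {Y : Θ → Type*}
    (f : ∀ θ, SimpleGraph (Fin 18) → Y θ) (hf : ∀ θ, f θ (graph 0) = f θ (graph 1)) :
    ¬ IsComplete f (simpleSpectrumGraphs M 18) := fun h => by
  obtain ⟨θ, hθ⟩ := h _ (mem_simpleSpectrumGraphs M 0) _ (mem_simpleSpectrumGraphs M 1)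
    not_nonempty_iso
  exact hθ (hf θ)

end Twist

end SpectralGNN

end

theorem mainTheorem7 (M : SpectralGNN.GraphMatrix) :
    (∃ n : ℕ, ¬ SpectralGNN.IsComplete
      (fun N : SpectralGNN.GraphormerGD => N.eval (V := Fin n))
      (SpectralGNN.simpleSpectrumGraphs M n)) ∧
    (∃ n : ℕ, ¬ SpectralGNN.IsComplete
      (SpectralGNN.prdWL (V := Fin n)) (SpectralGNN.simpleSpectrumGraphs M n)) ∧
    (∃ n : ℕ, ¬ SpectralGNN.IsComplete
      (SpectralGNN.diffWire (V := Fin n)) (SpectralGNN.simpleSpectrumGraphs M n)) ∧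
    (∃ n : ℕ, ¬ SpectralGNN.IsComplete
      (SpectralGNN.randomWalkGNN (V := Fin n)) (SpectralGNN.simpleSpectrumGraphs M n)) := by
  have hR := SpectralGNN.Twist.bisimulation
  have hA := SpectralGNN.Twist.compat_adj
  exact ⟨⟨18, SpectralGNN.Twist.not_isComplete M _ fun N => N.eval_eq hR hA⟩,
    ⟨18, SpectralGNN.Twist.not_isComplete M _ fun θ =>
      θ.2.eval_eq hR (SpectralGNN.Compat.prdFeature hR hA θ.1.1)⟩,
    ⟨18, SpectralGNN.Twist.not_isComplete M _ fun N =>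
      N.eval_eq hR (SpectralGNN.Compat.diffWireFeature hR hA)⟩,
    ⟨18, SpectralGNN.Twist.not_isComplete M _ fun N =>
      N.eval_eq hR (SpectralGNN.Compat.randomWalkFeature hR hA)⟩⟩
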